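/- **Setting.** Let $L\le K$, $\Theta=(0,1)^K$, and let the set of actions $\mathcal A$ consist of the ordered lists $a=(a_1,\dots,a_L)$ of $L$ distinct arms of $\{1,\dots,K\}$. Consider a bandit model with a finite observation space: when action $a$ is played under $\theta\in\Theta$, an observation $z$ is drawn, independently of the past given $a$, from a probability mass function $p_a(\cdot\,;\theta)$ that depends only on the parameters $(\theta_{a_1},\dots,\theta_{a_L})$ of the displayed arms; the laws $p_a(\cdot\,;\theta)$, $\theta\in\Theta$, are mutually absolutely continuous; a reward $r(a,z)$ is received. Let $\mu_a(\theta)$ be the expected reward of action $a$ and $\mu^*(\theta)=\max_{a\in\mathcal A}\mu_a(\theta)$. An algorithm selects $A(t)$, possibly at random, from the past actions and observations only, and then $Z(t)$ is observed. Let $N_a(T)=\sum_{t=1}^T\mathbf 1\{A(t)=a\}$, let $$\mathbb E_\theta[R(T)]=\mathbb E_\theta\Big[\sum_{t=1}^T\big(\mu^*(\theta)-r(A(t),Z(t))\big)\Big]$$ be the expected regret, and call the algorithm uniformly efficient if $\mathbb E_\theta[R(T)]=o(T^\alpha)$ for all $\theta\in\Theta$ and all $\alpha\in(0,1]$. Let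 $$\ell(t)=\sum_{s=1}^t\log\frac{p_{A(s)}(Z(s);\theta)}{p_{A(s)}(Z(s);\lambda)},\qquad B(\theta)=\{\lambda\in\Theta:\ \theta_l=\lambda_l\ \ \forall\, l\le L,\ \text{ and }\ \mu^*(\theta)<\mu^*(\lambda)\}.$$ **Proposition.** Fix a uniformly efficient algorithm. 1. Let $\theta\in\Theta$ be such that the arms $1,\dots,L$ are the optimal ones, that is, every action $a$ with $\mu_a(\theta)=\mu^*(\theta)$ is a list of these arms. Let $\lambda\in B(\theta)$, and assume that there are real numbers $I_a(\theta,\lambda)$ such that the expected log-likelihood ratio can be written as $\mathbb E_\theta[\ell(t)]=\sum_{a\in\mathcal A}I_a(\theta,\lambda)\,\mathbb E_\theta[N_a(t)]$ for all $t$. Then $$\liminf_{T\to\infty}\frac{\sum_{a\in\mathcal A}I_a(\theta,\lambda)\,\mathbb E_\theta[N_a(T)]}{\log T}\ \ge\ 1.$$ 2. In particular, consider the position-based model with examination parameters $1\ge\kappa_1>\dots>\kappa_L>0$: the observation is $Z=(Z_1,\dots,Z_L)$ with independent coordinates $Z_l=X_lY_l$, where $X_l\sim\mathcal B(\theta_{a_l})$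 and $Y_l\sim\mathcal B(\kappa_l)$ are independent Bernoulli variables, and the reward is $\sum_l Z_l$. If $\theta_1>\dots>\theta_K$, then the same inequality holds for every $\lambda\in B(\theta)$ with $I_a(\theta,\lambda)=\sum_{l=1}^L\sum_{k=1}^K\mathbf 1\{a_l=k\}\,I_l(\theta_k,\lambda_k)$, where $I_l(\theta_k,\lambda_k)$ is the expectation under $\theta$ of $\log\frac{p(Z_l;\theta)}{p(Z_l;\lambda)}$ when arm $k$ is shown at position $l$. -/

import Mathlib

open Filter Topology Asymptotics

noncomputable section

namespace RankingBandit

/-- The parameter set `Θ = (0,1)^K`. -/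
abbrev Param (K : ℕ) : Type := Fin K → Set.Ioo (0 : ℝ) 1

/-- Actions: ordered lists of `L` distinct arms among `K`. -/
abbrev Action (K L : ℕ) : Type := Fin L ↪ Fin K

/-- A stochastic bandit model with `K` arms whose actions are lists of `L` arms, with a finite
observation space `𝒵`. When the list `a` is played under the parameter `θ`, an observation with
probability mass function `p a θ` is drawn, independently of the past given `a`, and the reward is
`reward a z`. The law of the observation depends only on the parameters of the displayed arms, and
the laws for two parameters are mutually absolutely continuous. -/
structure Model (K L : ℕ) (𝒵 : Type*) [Fintype 𝒵] where
  /-- probability of the observation `z` when `a` is played under `θ` -/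
  p : Action K L → Param K → 𝒵 → ℝ
  p_nonneg : ∀ a θ z, 0 ≤ p a θ z
  p_sum : ∀ a θ, ∑ z, p a θ z = 1
  p_congr : ∀ a θ θ', (∀ l, θ (a l) = θ' (a l)) → p a θ = p a θ'
  p_ac : ∀ a θ θ' z, p a θ z = 0 → p a θ' z = 0
  /-- reward received when `a` is played and `z` is observed -/
  reward : Action K L → 𝒵 → ℝ

/-- Histories of `T` rounds: the successive actions and observations. -/
abbrev History (K L : ℕ) (𝒵 : Type*) (T : ℕ) : Type _ := Fin T → Action K L × 𝒵

/-- The history of the rounds that precede round `s`. -/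
def History.past {K L : ℕ} {𝒵 : Type*} {T : ℕ} (h : History K L 𝒵 T) (s : Fin T) :
    History K L 𝒵 s :=
  fun i => h ⟨i, i.isLt.trans s.isLt⟩

/-- A (possibly randomized) algorithm: `prob t h a` is the probability of playing `a` when the
`t` past rounds have produced the history `h`. It does not depend on the unknown parameter. -/
structure Algorithm (K L : ℕ) (𝒵 : Type*) where
  prob : (t : ℕ) → History K L 𝒵 t → Action K L → ℝ
  prob_nonneg : ∀ t h a, 0 ≤ prob t h a
  prob_sum : ∀ t h, ∑ a, prob t h a = 1

/-- `N_a(T)`: the number of times that `a` has been played. -/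
def numPlays {K L : ℕ} {𝒵 : Type*} {T : ℕ} (a : Action K L) (h : History K L 𝒵 T) : ℝ :=
  ∑ s, if (h s).1 = a then 1 else 0

namespace Model

variable {K L : ℕ} {𝒵 : Type*} [Fintype 𝒵] (M : Model K L 𝒵) (π : Algorithm K L 𝒵)

/-- `μ_a(θ)`: the expected reward of the action `a`. -/
def mean (a : Action K L) (θ : Param K) : ℝ := ∑ z, M.p a θ z * M.reward a z

/-- `μ*(θ)`: the best expected reward (a maximum over the finite set of actions). -/
def bestMean (θ : Param K) : ℝ := ⨆ a, M.mean a θ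

/-- Probability, under `θ`, that the first `T` rounds produce the history `h`. -/
def histProb (θ : Param K) {T : ℕ} (h : History K L 𝒵 T) : ℝ :=
  ∏ s : Fin T, π.prob s (h.past s) (h s).1 * M.p (h s).1 θ (h s).2

/-- `E_θ[f]`, for a function `f` of the first `T` rounds. -/
def expect (θ : Param K) {T : ℕ} (f : History K L 𝒵 T → ℝ) : ℝ :=
  ∑ h, M.histProb π θ h * f h

/-- The expected regret `E_θ[R(T)]` after `T` rounds. -/
def expRegret (θ : Param K) (T : ℕ) : ℝ :=
  M.expect π θ fun h : History K L 𝒵 T =>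
    ∑ s, (M.bestMean θ - M.reward (h s).1 (h s).2)

/-- The algorithm is uniformly efficient: `E_θ[R(T)] = o(T^α)` for all `θ ∈ Θ`, `α ∈ (0,1]`. -/
def UniformlyEfficient : Prop :=
  ∀ θ : Param K, ∀ α ∈ Set.Ioc (0 : ℝ) 1,
    (fun T : ℕ => M.expRegret π θ T) =o[atTop] fun T : ℕ => (T : ℝ) ^ α

/-- The log-likelihood ratio `ℓ(T)` of the observations, for the parameters `θ` and `lam`. -/
def llr (θ lam : Param K) {T : ℕ} (h : History K L 𝒵 T) : ℝ :=
  ∑ s, Real.log (M.p (h s).1 θ (h s).2 / M.p (h s).1 lam (h s).2)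

/-- The arms `1, …, L` (here `0, …, L - 1`) are the optimal ones at `θ`: every action with the
best expected reward is a list of these arms. -/
def FirstArmsOptimal (θ : Param K) : Prop :=
  ∀ a : Action K L, M.mean a θ = M.bestMean θ → ∀ l, (a l : ℕ) < L

/-- `B(θ)`: the parameters that coincide with `θ` on the first `L` arms and whose best expected
reward is larger than that of `θ`. -/
def altSet (θ : Param K) : Set (Param K) :=
  {lam | (∀ k : Fin K, (k : ℕ) < L → θ k = lam k) ∧ M.bestMean θ < M.bestMean lam}

end Model

/-! The position-based model. -/

/-- The probability mass function of the Bernoulli distribution with parameter `x`. -/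
def bern (x : ℝ) (b : Bool) : ℝ := if b then x else 1 - x

/-- The law of `Z = Y * X`, where `Y` and `X` are independent Bernoulli variables with parameters
`κ` and `x`. -/
def censored (κ x : ℝ) (z : Bool) : ℝ :=
  ∑ y : Bool, ∑ b : Bool, if (y && b) = z then bern κ y * bern x b else 0

theorem censored_true (κ x : ℝ) : censored κ x true = κ * x := by
  simp [censored, bern]

theorem censored_false (κ x : ℝ) : censored κ x false = 1 - κ * x := by
  simp [censored, bern]; ring

theorem censored_pos (κ : Set.Ioc (0 : ℝ) 1) (x : Set.Ioo (0 : ℝ) 1) (z : Bool) :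
    0 < censored κ x z := by
  obtain ⟨κ, h1, h2⟩ := κ
  obtain ⟨x, h3, h4⟩ := x
  cases z
  · simp only [censored_false]; nlinarith
  · simp only [censored_true]; positivity

/-- The position-based model with examination parameters `κ`: the observations
`Z_1, …, Z_L ∈ {0,1}` are independent, `Z_l = Y_l X_l` with `Y_l` and `X_l` independent Bernoulli
variables with parameters `κ_l` and `θ_{a_l}`, and the reward is `Z_1 + ⋯ + Z_L`. -/
def pbm {K L : ℕ} (κ : Fin L → Set.Ioc (0 : ℝ) 1) : Model K L (Fin L → Bool) where
  p a θ z := ∏ l, censored (κ l) (θ (a l)) (z l)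
  p_nonneg a θ z := Finset.prod_nonneg fun l _ => (censored_pos (κ l) (θ (a l)) (z l)).le
  p_sum a θ := by
    rw [← Fintype.prod_sum fun l (b : Bool) => censored (κ l) (θ (a l)) b]
    exact Finset.prod_eq_one fun l _ => by
      rw [Fintype.sum_bool, censored_true, censored_false]; ring
  p_congr a θ θ' h := by simp only [h]
  p_ac a θ θ' z h :=
    absurd h (Finset.prod_pos fun l _ => censored_pos (κ l) (θ (a l)) (z l)).ne'
  reward _ z := ∑ l, if z l then 1 else 0

/-- The local information `I_l(x, y)` at a position with examination parameter `κ`: the expectation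
of the log-likelihood ratio of `Z_l` when the displayed arm has parameter `x`, against `y`. -/
def localInfo (κ x y : ℝ) : ℝ :=
  ∑ z : Bool, censored κ x z * Real.log (censored κ x z / censored κ y z)

/-- `I_a(θ, λ) = ∑_l ∑_k 1{a_l = k} I_l(θ_k, λ_k)` in the position-based model. -/
def pbmInfo {K L : ℕ} (κ : Fin L → Set.Ioc (0 : ℝ) 1) (θ lam : Param K) (a : Action K L) : ℝ :=
  ∑ l, ∑ k, if a l = k then localInfo (κ l) (θ k) (lam k) else 0

end RankingBandit

end

/-!
The proof is a change of measure between `θ` and `lam`. Write `N(T)` for the number of rounds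
`t ≤ T` in which the displayed list consists of the first `L` arms (`numFirst`).

Lists of the first arms have the same law under `θ` and `lam`, hence the same mean, so they are
suboptimal under `lam` by at least `μ*(lam) - μ*(θ) > 0`, whereas all other lists are suboptimal
under `θ`. Uniform efficiency therefore gives `E_lam[N(T)] = o(T^α)` for every `α ∈ (0, 1]` and
`E_θ[N(T)] / T → 1` (`tendsto_expect_numFirst_alt` and `tendsto_expect_numFirst`).

The expectation `E_θ[ℓ(T)]` is the Kullback-Leibler divergence of the laws of the history, so
`E_θ[ℓ(T)] ≥ E_θ[g] + 1 - E_lam[exp g]` for every function `g` of the history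
(`expect_add_one_sub_expect_exp_le`). Take `g = (1 - α) log T * N(T) / T`. As `N(T) / T ∈ [0, 1]`,
convexity of the exponential gives `exp g ≤ 1 + T^(1 - α) * N(T) / T`, and hence
`E_θ[ℓ(T)] ≥ (1 - α) log T * E_θ[N(T)] / T - E_lam[N(T)] / T^α`
(`le_expect_llr`). Divide by `log T`, and let `T → ∞` and then `α → 0`.

For the position-based model, an exchange argument shows that the first arms are optimal
(`pbm_firstArmsOptimal`), and the decomposition of `E_θ[ℓ(T)]` over the actions holds because the
logarithm of a product law is a sum over the positions (`pbm_expect_llr`).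
-/

namespace RankingBandit

/-- The list `a` consists of the first `L` arms. -/
def UsesFirstArms {K L : ℕ} (a : Action K L) : Prop := ∀ l, (a l : ℕ) < L

open Classical in
/-- The number of rounds in which a list of the first `L` arms has been played. -/
noncomputable def numFirst {K L : ℕ} {𝒵 : Type*} {T : ℕ} (h : History K L 𝒵 T) : ℝ :=
  ∑ s, if UsesFirstArms (h s).1 then 1 else 0

theorem numFirst_nonneg {K L : ℕ} {𝒵 : Type*} {T : ℕ} (h : History K L 𝒵 T) : 0 ≤ numFirst h :=
  Finset.sum_nonneg fun _ _ => by split_ifs <;> norm_num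

theorem numFirst_le {K L : ℕ} {𝒵 : Type*} {T : ℕ} (h : History K L 𝒵 T) : numFirst h ≤ T := by
  refine (Finset.sum_le_sum (g := fun _ => (1 : ℝ)) fun s _ => ?_).trans (by simp)
  split_ifs <;> norm_num

theorem sum_comp_eq_sum_mul_numPlays {K L : ℕ} {𝒵 : Type*} {T : ℕ} (g : Action K L → ℝ)
    (h : History K L 𝒵 T) : ∑ s, g (h s).1 = ∑ a, g a * numPlays a h := by
  simp only [numPlays, Finset.mul_sum]
  rw [Finset.sum_comm]
  simp

namespace Model

variable {K L : ℕ} {𝒵 : Type*} [Fintype 𝒵] (M : Model K L 𝒵) (π : Algorithm K L 𝒵)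

/-! ### Expectations over histories -/

theorem histProb_nonneg (θ : Param K) {T : ℕ} (h : History K L 𝒵 T) : 0 ≤ M.histProb π θ h :=
  Finset.prod_nonneg fun _ _ => mul_nonneg (π.prob_nonneg _ _ _) (M.p_nonneg _ _ _)

theorem expect_mono (θ : Param K) {T : ℕ} {f g : History K L 𝒵 T → ℝ} (hfg : ∀ h, f h ≤ g h) :
    M.expect π θ f ≤ M.expect π θ g :=
  Finset.sum_le_sum fun h _ => mul_le_mul_of_nonneg_left (hfg h) (M.histProb_nonneg π θ h)

theorem expect_add (θ : Param K) {T : ℕ} (f g : History K L 𝒵 T → ℝ) :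
    M.expect π θ (fun h => f h + g h) = M.expect π θ f + M.expect π θ g := by
  simp only [expect, mul_add, Finset.sum_add_distrib]

theorem expect_const_mul (θ : Param K) {T : ℕ} (c : ℝ) (f : History K L 𝒵 T → ℝ) :
    M.expect π θ (fun h => c * f h) = c * M.expect π θ f := by
  simp only [expect, Finset.mul_sum]
  exact Finset.sum_congr rfl fun _ _ => by ring

theorem expect_finset_sum (θ : Param K) {T : ℕ} {ι : Type*} (s : Finset ι)
    (f : ι → History K L 𝒵 T → ℝ) :
    M.expect π θ (fun h => ∑ i ∈ s, f i h) = ∑ i ∈ s, M.expect π θ (f i) := by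
  simp only [expect, Finset.mul_sum]
  exact Finset.sum_comm

theorem histProb_snoc (θ : Param K) {T : ℕ} (h : History K L 𝒵 T) (x : Action K L × 𝒵) :
    M.histProb π θ (Fin.snoc h x : History K L 𝒵 (T + 1)) =
      M.histProb π θ h * (π.prob T h x.1 * M.p x.1 θ x.2) := by
  have past_castSucc (s : Fin T) :
      History.past (Fin.snoc h x : History K L 𝒵 (T + 1)) s.castSucc = h.past s := by
    funext i
    exact Fin.snoc_castSucc (α := fun _ => Action K L × 𝒵) x h ⟨i, i.isLt.trans s.isLt⟩
  have past_last :
      History.past (Fin.snoc h x : History K L 𝒵 (T + 1)) (Fin.last T) = h := by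
    funext i
    exact Fin.snoc_castSucc (α := fun _ => Action K L × 𝒵) x h i
  unfold histProb
  rw [Fin.prod_univ_castSucc]
  simp only [Fin.snoc_castSucc, Fin.snoc_last, past_castSucc]
  congr 2
  exact congrArg (fun h' => π.prob T h' x.1) past_last

/-- The tower property: condition on the first `T` of `T + 1` rounds. -/
theorem expect_succ (θ : Param K) {T : ℕ} (f : History K L 𝒵 (T + 1) → ℝ) :
    M.expect π θ f = M.expect π θ fun h : History K L 𝒵 T =>
      ∑ a, π.prob T h a * ∑ z, M.p a θ z * f (Fin.snoc h (a, z)) := by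
  unfold expect
  rw [← (Fin.snocEquiv fun _ => Action K L × 𝒵).sum_comp, Fintype.sum_prod_type_right]
  refine Finset.sum_congr rfl fun h _ => ?_
  rw [Fintype.sum_prod_type, Finset.mul_sum]
  refine Finset.sum_congr rfl fun a _ => ?_
  rw [Finset.mul_sum, Finset.mul_sum]
  refine Finset.sum_congr rfl fun z _ => ?_
  have := M.histProb_snoc π θ h (a, z)
  simp only [Fin.snocEquiv, Equiv.coe_fn_mk]
  rw [this]
  ring

theorem expect_const (θ : Param K) (T : ℕ) (c : ℝ) :
    M.expect π θ (fun _ : History K L 𝒵 T => c) = c := by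
  induction T with
  | zero => simp [expect, histProb]
  | succ T ih =>
    rw [expect_succ]
    simpa only [← Finset.sum_mul, M.p_sum, π.prob_sum, one_mul] using ih

/-- A reward collected in every round may be replaced by its mean given the action. -/
theorem expect_sum_eq_expect_sum_mean (θ : Param K) (g : Action K L → 𝒵 → ℝ) (T : ℕ) :
    M.expect π θ (fun h : History K L 𝒵 T => ∑ s, g (h s).1 (h s).2) =
      M.expect π θ (fun h : History K L 𝒵 T => ∑ s, ∑ z, M.p (h s).1 θ z * g (h s).1 z) := by
  induction T with
  | zero => simp
  | succ T ih =>
    rw [expect_succ, expect_succ M π θ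
      (fun h : History K L 𝒵 (T + 1) => ∑ s, ∑ z, M.p (h s).1 θ z * g (h s).1 z)]
    simp only [Fin.sum_univ_castSucc, Fin.snoc_castSucc, Fin.snoc_last, mul_add,
      Finset.sum_add_distrib, ← Finset.sum_mul, M.p_sum, π.prob_sum, one_mul]
    rw [expect_add, expect_add, ih]

/-! ### The change of measure -/

/-- On a history of positive probability the choices of the algorithm, which do not depend on the
parameter, cancel in the likelihood ratio. Mutual absolute continuity keeps the denominator
positive. -/
theorem llr_eq_log (θ lam : Param K) {T : ℕ} {h : History K L 𝒵 T}
    (hpos : 0 < M.histProb π θ h) :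
    0 < M.histProb π lam h ∧
      M.llr θ lam h = Real.log (M.histProb π θ h / M.histProb π lam h) := by
  have hne (s : Fin T) : π.prob s (h.past s) (h s).1 * M.p (h s).1 θ (h s).2 ≠ 0 :=
    Finset.prod_ne_zero_iff.1 hpos.ne' s (Finset.mem_univ s)
  have hne' (s : Fin T) : M.p (h s).1 lam (h s).2 ≠ 0 := fun h0 =>
    right_ne_zero_of_mul (hne s) (M.p_ac _ _ _ _ h0)
  refine ⟨(M.histProb_nonneg π lam h).lt_of_ne' <| Finset.prod_ne_zero_iff.2 fun s _ =>
    mul_ne_zero (left_ne_zero_of_mul (hne s)) (hne' s), ?_⟩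
  unfold histProb llr
  rw [← Finset.prod_div_distrib, Real.log_prod fun s _ =>
    div_ne_zero (hne s) (mul_ne_zero (left_ne_zero_of_mul (hne s)) (hne' s))]
  exact Finset.sum_congr rfl fun s _ => by
    rw [mul_div_mul_left _ _ (left_ne_zero_of_mul (hne s))]

/-- The variational lower bound for the Kullback-Leibler divergence
`E_θ[ℓ]`: it is at least `E_θ[g] + 1 - E_lam[exp g]` for every function `g` of the history. -/
theorem expect_add_one_sub_expect_exp_le (θ lam : Param K) {T : ℕ} (g : History K L 𝒵 T → ℝ) :
    M.expect π θ g + 1 - M.expect π lam (fun h => Real.exp (g h)) ≤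
      M.expect π θ (fun h : History K L 𝒵 T => M.llr θ lam h) := by
  suffices M.expect π θ (fun h => g h + 1) ≤
      M.expect π θ (fun h : History K L 𝒵 T => M.llr θ lam h) +
        M.expect π lam (fun h => Real.exp (g h)) by
    rw [expect_add, expect_const] at this
    linarith
  unfold expect
  rw [← Finset.sum_add_distrib]
  refine Finset.sum_le_sum fun h _ => ?_
  have hq := M.histProb_nonneg π lam h
  rcases (M.histProb_nonneg π θ h).eq_or_lt with h0 | hp
  · rw [← h0]
    simp only [zero_mul, zero_add]
    positivity
  · obtain ⟨hq, hl⟩ := M.llr_eq_log π θ lam hp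
    beta_reduce
    rw [hl]
    generalize M.histProb π θ h = p at *
    generalize M.histProb π lam h = q at *
    -- `log x ≤ x - 1` at `x = q * exp (g h) / p`, multiplied by `p`
    have hx := Real.log_le_sub_one_of_pos (show 0 < q * Real.exp (g h) / p by positivity)
    rw [Real.log_div (by positivity) hp.ne', Real.log_mul hq.ne' (by positivity),
      Real.log_exp] at hx
    have hp' := mul_le_mul_of_nonneg_left hx hp.le
    have : p * (q * Real.exp (g h) / p - 1) = q * Real.exp (g h) - p := by field_simp
    rw [Real.log_div hp.ne' hq.ne']
    nlinarith

/-- The change of measure with the function `(β log T / T) * numFirst`, whose exponential is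
bounded by convexity. -/
theorem le_expect_llr (θ lam : Param K) (β : ℝ) {T : ℕ} (hT : 0 < T) :
    β * Real.log T * (M.expect π θ (fun h : History K L 𝒵 T => numFirst h) / T) -
        (T : ℝ) ^ β * (M.expect π lam (fun h : History K L 𝒵 T => numFirst h) / T) ≤
      M.expect π θ (fun h : History K L 𝒵 T => M.llr θ lam h) := by
  have hT' : (0 : ℝ) < T := by exact_mod_cast hT
  have key := M.expect_add_one_sub_expect_exp_le π θ lam
    (fun h : History K L 𝒵 T => β * Real.log T / T * numFirst h)
  have hexp : M.expect π lam
        (fun h : History K L 𝒵 T => Real.exp (β * Real.log T / T * numFirst h)) ≤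
      M.expect π lam (fun h : History K L 𝒵 T => 1 + (T : ℝ) ^ β / T * numFirst h) := by
    refine M.expect_mono π lam fun h => ?_
    have hx0 : 0 ≤ numFirst h / T := div_nonneg (numFirst_nonneg h) hT'.le
    have hx1 : numFirst h / T ≤ 1 := (div_le_one hT').2 (numFirst_le h)
    have hconv := convexOn_exp.2 (Set.mem_univ (0 : ℝ)) (Set.mem_univ (β * Real.log T))
      (sub_nonneg.2 hx1) hx0 (by ring)
    simp only [smul_eq_mul, mul_zero, zero_add, Real.exp_zero, mul_one] at hconv
    rw [mul_comm β, ← Real.rpow_def_of_pos hT'] at hconv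
    calc Real.exp (β * Real.log T / T * numFirst h)
        = Real.exp (numFirst h / T * (Real.log T * β)) := by congr 1; ring
      _ ≤ 1 - numFirst h / T + numFirst h / T * (T : ℝ) ^ β := hconv
      _ ≤ 1 + numFirst h / T * (T : ℝ) ^ β := by linarith
      _ = 1 + (T : ℝ) ^ β / T * numFirst h := by ring
  rw [expect_add, expect_const, expect_const_mul] at hexp
  rw [expect_const_mul] at key
  calc _ = β * Real.log T / T * M.expect π θ (fun h : History K L 𝒵 T => numFirst h) + 1 -
        (1 + (T : ℝ) ^ β / T * M.expect π lam (fun h : History K L 𝒵 T => numFirst h)) := by ring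
    _ ≤ _ := (sub_le_sub_left hexp _).trans key

/-! ### Regret and the number of plays of the first arms -/

theorem mean_le_bestMean (a : Action K L) (θ : Param K) : M.mean a θ ≤ M.bestMean θ :=
  le_ciSup (f := fun a => M.mean a θ) (Set.finite_range _).bddAbove a

theorem expRegret_eq (θ : Param K) (T : ℕ) :
    M.expRegret π θ T =
      M.expect π θ fun h : History K L 𝒵 T => ∑ s, (M.bestMean θ - M.mean (h s).1 θ) := by
  refine (M.expect_sum_eq_expect_sum_mean π θ (fun a z => M.bestMean θ - M.reward a z) T).trans ?_
  simp only [mul_sub, Finset.sum_sub_distrib, ← Finset.sum_mul, M.p_sum, one_mul, mean]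

theorem mean_eq_of_mem_altSet {θ lam : Param K} (hlam : lam ∈ M.altSet θ) {a : Action K L}
    (ha : UsesFirstArms a) : M.mean a lam = M.mean a θ := by
  unfold mean
  rw [M.p_congr a lam θ fun l => (hlam.1 (a l) (ha l)).symm]

/-- Under an alternative parameter, every play of a list of the first arms costs at least
`μ*(lam) - μ*(θ)`. -/
theorem gap_mul_expect_numFirst_le {θ lam : Param K} (hlam : lam ∈ M.altSet θ) (T : ℕ) :
    (M.bestMean lam - M.bestMean θ) *
        M.expect π lam (fun h : History K L 𝒵 T => numFirst h) ≤ M.expRegret π lam T := by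
  rw [expRegret_eq, ← expect_const_mul]
  refine M.expect_mono π lam fun h => ?_
  rw [numFirst, Finset.mul_sum]
  refine Finset.sum_le_sum fun s _ => ?_
  split_ifs with hs
  · rw [M.mean_eq_of_mem_altSet hlam hs]
    linarith [M.mean_le_bestMean (h s).1 θ]
  · linarith [M.mean_le_bestMean (h s).1 lam]

/-- If the first arms are optimal, every play of another list costs at least some `Δ > 0`. -/
theorem exists_gap_mul_le_expRegret {θ : Param K} (hθ : M.FirstArmsOptimal θ) :
    ∃ Δ > 0, ∀ T : ℕ,
      Δ * (T - M.expect π θ (fun h : History K L 𝒵 T => numFirst h)) ≤ M.expRegret π θ T := by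
  classical
  obtain ⟨Δ, hΔ, hgap⟩ : ∃ Δ > 0, ∀ a : Action K L, ¬ UsesFirstArms a →
      Δ ≤ M.bestMean θ - M.mean a θ := by
    cases isEmpty_or_nonempty (Action K L)
    · exact ⟨1, one_pos, fun a => isEmptyElim a⟩
    obtain ⟨a₀, ha₀⟩ := Finite.exists_min fun a : Action K L =>
      if UsesFirstArms a then 1 else M.bestMean θ - M.mean a θ
    refine ⟨_, ?_, fun a ha => (ha₀ a).trans_eq (if_neg ha)⟩
    split_ifs with h
    · exact one_pos
    · exact sub_pos.2 ((M.mean_le_bestMean a₀ θ).lt_of_ne fun h' => h (hθ a₀ h'))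
  refine ⟨Δ, hΔ, fun T => ?_⟩
  have : (T : ℝ) - M.expect π θ (fun h : History K L 𝒵 T => numFirst h) =
      M.expect π θ (fun h : History K L 𝒵 T => T + (-1) * numFirst h) := by
    rw [expect_add, expect_const, expect_const_mul]
    ring
  rw [this, ← expect_const_mul, expRegret_eq]
  refine M.expect_mono π θ fun h => ?_
  have hT : (T : ℝ) + (-1) * numFirst h =
      ∑ s, (1 - if UsesFirstArms (h s).1 then (1 : ℝ) else 0) := by
    rw [Finset.sum_sub_distrib]
    simp [numFirst, sub_eq_add_neg]
  rw [hT, Finset.mul_sum]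
  refine Finset.sum_le_sum fun s _ => ?_
  split_ifs with hs
  · linarith [M.mean_le_bestMean (h s).1 θ]
  · linarith [hgap _ hs]

variable {M π}

theorem UniformlyEfficient.tendsto_div_rpow (hπ : M.UniformlyEfficient π) (θ : Param K) {α : ℝ}
    (hα : α ∈ Set.Ioc (0 : ℝ) 1) :
    Tendsto (fun T : ℕ => M.expRegret π θ T / (T : ℝ) ^ α) atTop (𝓝 0) :=
  (hπ θ α hα).tendsto_div_nhds_zero

theorem UniformlyEfficient.tendsto_expect_numFirst_alt (hπ : M.UniformlyEfficient π)
    {θ lam : Param K} (hlam : lam ∈ M.altSet θ) {α : ℝ} (hα : α ∈ Set.Ioc (0 : ℝ) 1) :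
    Tendsto (fun T : ℕ => M.expect π lam (fun h : History K L 𝒵 T => numFirst h) / (T : ℝ) ^ α)
      atTop (𝓝 0) := by
  have hδ : 0 < M.bestMean lam - M.bestMean θ := sub_pos.2 hlam.2
  have hlim := (hπ.tendsto_div_rpow lam hα).div_const (M.bestMean lam - M.bestMean θ)
  rw [zero_div] at hlim
  refine squeeze_zero (fun T => div_nonneg ?_ (by positivity)) (fun T => ?_) hlim
  · exact (M.expect_const π lam T 0).symm.le.trans
      (M.expect_mono π lam fun h => numFirst_nonneg h)
  · rw [div_right_comm]
    gcongr
    rw [le_div_iff₀' hδ]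
    exact M.gap_mul_expect_numFirst_le π hlam T

theorem UniformlyEfficient.tendsto_expect_numFirst (hπ : M.UniformlyEfficient π)
    {θ : Param K} (hθ : M.FirstArmsOptimal θ) :
    Tendsto (fun T : ℕ => M.expect π θ (fun h : History K L 𝒵 T => numFirst h) / T)
      atTop (𝓝 1) := by
  obtain ⟨Δ, hΔ, hR⟩ := M.exists_gap_mul_le_expRegret π hθ
  have hlim := (hπ.tendsto_div_rpow θ (Set.right_mem_Ioc.2 one_pos)).div_const Δ
  simp only [Real.rpow_one, zero_div] at hlim
  refine tendsto_of_tendsto_of_tendsto_of_le_of_le'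
    (g := fun T : ℕ => 1 - M.expRegret π θ T / T / Δ) (by simpa using hlim.const_sub 1) tendsto_const_nhds ?_ ?_
  · filter_upwards [eventually_gt_atTop 0] with T hT
    have hT' : (0 : ℝ) < T := by exact_mod_cast hT
    rw [div_right_comm, sub_le_iff_le_add, ← add_div, le_div_iff₀ hT', one_mul,
      ← sub_le_iff_le_add', le_div_iff₀' hΔ]
    exact hR T
  · filter_upwards with T
    refine div_le_one_of_le₀ ?_ T.cast_nonneg
    exact (M.expect_mono π θ fun h => numFirst_le h).trans_eq (M.expect_const π θ T _)

/-- The lower bound on the expected log-likelihood ratio, in any model. -/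
theorem UniformlyEfficient.one_le_liminf_expect_llr_div_log (hπ : M.UniformlyEfficient π)
    {θ lam : Param K} (hθ : M.FirstArmsOptimal θ) (hlam : lam ∈ M.altSet θ) :
    (1 : EReal) ≤ liminf (fun T : ℕ =>
      ((M.expect π θ (fun h : History K L 𝒵 T => M.llr θ lam h) / Real.log T : ℝ) : EReal))
      atTop := by
  refine le_of_forall_lt_imp_le_of_dense fun c hc => ?_
  obtain ⟨r, hcr, hr⟩ := EReal.lt_iff_exists_real_btwn.1 hc
  have hr1 : r < 1 := by exact_mod_cast hr
  refine hcr.le.trans (le_liminf_of_le (by isBoundedDefault) ?_)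
  set α : ℝ := min 1 ((1 - r) / 2) with hαdef
  have hα : α ∈ Set.Ioc (0 : ℝ) 1 := ⟨lt_min one_pos (by linarith), min_le_left _ _⟩
  have hrα : r < 1 - α := by linarith [min_le_right (1 : ℝ) ((1 - r) / 2)]
  have hlim := ((hπ.tendsto_expect_numFirst hθ).const_mul (1 - α)).sub
    (hπ.tendsto_expect_numFirst_alt hlam hα)
  rw [mul_one, sub_zero] at hlim
  have hlog : ∀ᶠ T : ℕ in atTop, 1 ≤ Real.log T :=
    (Real.tendsto_log_atTop.comp tendsto_natCast_atTop_atTop).eventually_ge_atTop 1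
  filter_upwards [hlim.eventually_const_lt hrα, hlog, eventually_gt_atTop 0] with T h1 h2 hT
  have hT' : (0 : ℝ) < T := by exact_mod_cast hT
  have hl := M.le_expect_llr π θ lam (1 - α) hT
  have hpow : (T : ℝ) ^ (1 - α) *
      (M.expect π lam (fun h : History K L 𝒵 T => numFirst h) / T) =
      M.expect π lam (fun h : History K L 𝒵 T => numFirst h) / (T : ℝ) ^ α := by
    rw [Real.rpow_sub hT', Real.rpow_one]
    field_simp
  have hnonneg : 0 ≤ M.expect π lam (fun h : History K L 𝒵 T => numFirst h) / (T : ℝ) ^ α :=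
    div_nonneg ((M.expect_const π lam T 0).symm.le.trans
      (M.expect_mono π lam fun h => numFirst_nonneg h)) (by positivity)
  rw [hpow] at hl
  rw [EReal.coe_le_coe_iff, le_div_iff₀ (by linarith)]
  nlinarith

end Model

/-! ### The position-based model -/

section PositionBased

variable {K L : ℕ} (κ : Fin L → Set.Ioc (0 : ℝ) 1)

/-- A coordinate of a product law has the corresponding marginal. -/
theorem sum_prod_mul_apply {ι β : Type*} [Fintype ι] [DecidableEq ι] [Fintype β] (w : ι → β → ℝ)
    (hw : ∀ i, ∑ b, w i b = 1) (j : ι) (g : β → ℝ) :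
    ∑ z : ι → β, (∏ i, w i (z i)) * g (z j) = ∑ b, w j b * g b := by
  have h (z : ι → β) : (∏ i, w i (z i)) * g (z j) =
      ∏ i, w i (z i) * (if i = j then g (z i) else 1) := by
    rw [Finset.prod_mul_distrib]
    simp
  simp only [h]
  rw [← Fintype.prod_sum fun i b => w i b * (if i = j then g b else 1),
    Fintype.prod_eq_single j fun i hi => by simp [hi, hw]]
  simp

theorem sum_censored (κ x : ℝ) : ∑ z, censored κ x z = 1 := by
  rw [Fintype.sum_bool, censored_true, censored_false]
  ring

theorem pbm_mean (a : Action K L) (θ : Param K) :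
    (pbm κ).mean a θ = ∑ l, (κ l : ℝ) * θ (a l) := by
  simp only [Model.mean, pbm, Finset.mul_sum]
  rw [Finset.sum_comm]
  refine Finset.sum_congr rfl fun l _ => ?_
  rw [sum_prod_mul_apply (fun l => censored (κ l) (θ (a l))) (fun l => sum_censored _ _) l
    (fun b => if b then 1 else 0)]
  simp [censored_true]

/-- An exchange argument: a list that shows an arm outside the first `L` misses one of the first
`L`, and is improved by showing the latter instead. -/
theorem pbm_firstArmsOptimal {θ : Param K} (hLK : L ≤ K) (hθ : StrictAnti θ) :
    (pbm κ).FirstArmsOptimal θ := by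
  intro a ha l₀
  by_contra! hl₀
  obtain ⟨k, hk⟩ : ∃ k : Fin L, ∀ l, a l ≠ Fin.castLE hLK k := by
    -- otherwise `a` shows all first arms, hence, having `L` positions, nothing else
    by_contra! h
    choose f hf using h
    have hinj : Function.Injective f := fun i j hij => by
      have := (hf i).symm.trans ((congrArg a hij).trans (hf j))
      exact Fin.castLE_injective hLK this
    obtain ⟨i, hi⟩ := Finite.surjective_of_injective hinj l₀
    have := hf i
    rw [hi] at this
    have := congrArg Fin.val this
    rw [Fin.val_castLE] at this
    omega
  let b : Action K L := ⟨Function.update a l₀ (Fin.castLE hLK k),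
    fun i j hij => by
      rcases eq_or_ne i l₀ with hi | hi <;> rcases eq_or_ne j l₀ with hj | hj
      · exact hi.trans hj.symm
      · rw [hi, Function.update_self, Function.update_of_ne hj] at hij
        exact absurd hij.symm (hk j)
      · rw [hj, Function.update_self, Function.update_of_ne hi] at hij
        exact absurd hij (hk i)
      · rw [Function.update_of_ne hi, Function.update_of_ne hj] at hij
        exact a.injective hij⟩
  have hb : (pbm κ).mean a θ < (pbm κ).mean b θ := by
    rw [pbm_mean, pbm_mean]
    have hl : (κ l₀ : ℝ) * θ (a l₀) < κ l₀ * θ (b l₀) := by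
      refine mul_lt_mul_of_pos_left ?_ (κ l₀).2.1
      have hbl : b l₀ = Fin.castLE hLK k := Function.update_self ..
      rw [hbl]
      exact hθ (Fin.lt_def.2 (k.isLt.trans_le hl₀))
    refine Finset.sum_lt_sum (fun l _ => ?_) ⟨l₀, Finset.mem_univ _, hl⟩
    rcases eq_or_ne l l₀ with rfl | hne
    · exact hl.le
    · have hbl : b l = a l := Function.update_of_ne hne ..
      rw [hbl]
  exact absurd ((pbm κ).mean_le_bestMean b θ) (not_le.2 (ha ▸ hb))

theorem pbmInfo_eq (θ lam : Param K) (a : Action K L) :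
    pbmInfo κ θ lam a = ∑ z, (pbm κ).p a θ z *
      Real.log ((pbm κ).p a θ z / (pbm κ).p a lam z) := by
  have hpos (θ : Param K) (l : Fin L) (b : Bool) : 0 < censored (κ l) (θ (a l)) b :=
    censored_pos _ _ _
  have hlog (z : Fin L → Bool) : Real.log ((pbm κ).p a θ z / (pbm κ).p a lam z) =
      ∑ l, Real.log (censored (κ l) (θ (a l)) (z l) / censored (κ l) (lam (a l)) (z l)) := by
    simp only [pbm]
    rw [← Finset.prod_div_distrib,
      Real.log_prod fun l _ => (div_pos (hpos θ l _) (hpos lam l _)).ne']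
  simp only [hlog, Finset.mul_sum]
  rw [Finset.sum_comm]
  refine Finset.sum_congr rfl fun l _ => ?_
  rw [Finset.sum_ite_eq, if_pos (Finset.mem_univ _)]
  exact (sum_prod_mul_apply (fun l => censored (κ l) (θ (a l))) (fun l => sum_censored _ _) l
    (fun b => Real.log (censored (κ l) (θ (a l)) b / censored (κ l) (lam (a l)) b))).symm

theorem pbm_expect_llr (π : Algorithm K L (Fin L → Bool)) (θ lam : Param K) (T : ℕ) :
    (pbm κ).expect π θ (fun h : History K L (Fin L → Bool) T => (pbm κ).llr θ lam h) =
      ∑ a, pbmInfo κ θ lam a *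
        (pbm κ).expect π θ (fun h : History K L (Fin L → Bool) T => numPlays a h) := by
  refine ((pbm κ).expect_sum_eq_expect_sum_mean π θ
    (fun a z => Real.log ((pbm κ).p a θ z / (pbm κ).p a lam z)) T).trans ?_
  simp only [← pbmInfo_eq, sum_comp_eq_sum_mul_numPlays, Model.expect_finset_sum,
    Model.expect_const_mul]

end PositionBased

end RankingBandit

/-- Part 1: any model in which the expected log-likelihood ratio decomposes over the actions.
Part 2: the position-based model, where it does decompose, with `I_a` built from the local amounts
of information. The limits inferior are taken in the extended reals. -/
theorem proposition1 (K L : ℕ) (hLK : L ≤ K) :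
    (∀ (𝒵 : Type*) [Fintype 𝒵] (M : RankingBandit.Model K L 𝒵)
      (π : RankingBandit.Algorithm K L 𝒵) (_hπ : M.UniformlyEfficient π)
      (θ : RankingBandit.Param K) (_hθ : M.FirstArmsOptimal θ)
      (I : RankingBandit.Param K → RankingBandit.Param K → RankingBandit.Action K L → ℝ),
      ∀ lam ∈ M.altSet θ,
        (∀ t : ℕ, M.expect π θ (fun h : RankingBandit.History K L 𝒵 t => M.llr θ lam h) =
          ∑ a, I θ lam a *
            M.expect π θ (fun h : RankingBandit.History K L 𝒵 t => RankingBandit.numPlays a h)) →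
        (1 : EReal) ≤ liminf (fun T : ℕ => (((∑ a, I θ lam a *
            M.expect π θ (fun h : RankingBandit.History K L 𝒵 T => RankingBandit.numPlays a h)) /
            Real.log T : ℝ) : EReal)) atTop) ∧
    (∀ (κ : Fin L → Set.Ioc (0 : ℝ) 1) (_hκ : StrictAnti κ)
      (π : RankingBandit.Algorithm K L (Fin L → Bool))
      (_hπ : (RankingBandit.pbm κ).UniformlyEfficient π)
      (θ : RankingBandit.Param K) (_hθ : StrictAnti θ),
      ∀ lam ∈ (RankingBandit.pbm κ).altSet θ,
        (1 : EReal) ≤ liminf (fun T : ℕ => (((∑ a, RankingBandit.pbmInfo κ θ lam a *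
            (RankingBandit.pbm κ).expect π θ (fun h : RankingBandit.History K L (Fin L → Bool) T =>
              RankingBandit.numPlays a h)) / Real.log T : ℝ) : EReal)) atTop) := by
  refine ⟨fun 𝒵 _ M π hπ θ hθ I lam hlam hI => ?_, fun κ _ π hπ θ hθ lam hlam => ?_⟩
  · simp only [← hI]
    exact hπ.one_le_liminf_expect_llr_div_log hθ hlam
  · simp only [← RankingBandit.pbm_expect_llr]
    exact hπ.one_le_liminf_expect_llr_div_log
      (RankingBandit.pbm_firstArmsOptimal κ hLK hθ) hlam
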